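/- A subset $B$ of a group $G$ is called a *difference basis* for a subset $A\subseteq G$ if each $a\in A$ can be written as $a=xy^{-1}$ for some $x,y\in B$. The *difference size* $\Delta[A]$ is the smallest cardinality of a difference basis $B\subseteq G$ for $A$. For $n\ge 1$ let $C_n=\{z\in\mathbb C: z^n=1\}$ be the cyclic group of complex $n$-th roots of unity. Then for every prime number $p$ the cyclic group $C_{p^2-p}$ has difference size $$\Delta[C_{p^2-p}]\le p-3+\frac{12}{\sqrt{73}}\big(\sqrt{p}+\sqrt{p-1}\big).$$ -/

import Mathlib

/-- `B` is a difference basis for `A ⊆ G`: each `a ∈ A` can be written as `a = x * y⁻¹`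
with `x, y ∈ B`. -/
def IsDifferenceBasis {G : Type*} [Group G] (B A : Set G) : Prop :=
  ∀ a ∈ A, ∃ x ∈ B, ∃ y ∈ B, a = x * y⁻¹

/-- The difference size `Δ[A]`: the smallest cardinality of a (finite) difference basis for `A`.
For finite `G` a difference basis always exists, see `exists_isDifferenceBasis_card_eq`. -/
noncomputable def differenceSize {G : Type*} [Group G] (A : Set G) : ℕ :=
  sInf {k : ℕ | ∃ B : Finset G, IsDifferenceBasis (B : Set G) A ∧ B.card = k}

/-- In a finite group the minimum defining the difference size is attained. -/
theorem exists_isDifferenceBasis_card_eq {G : Type*} [Group G] [Finite G] (A : Set G) :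
    ∃ B : Finset G, IsDifferenceBasis (B : Set G) A ∧ B.card = differenceSize A := by
  have := Fintype.ofFinite G
  have h : {k : ℕ | ∃ B : Finset G, IsDifferenceBasis (B : Set G) A ∧ B.card = k}.Nonempty :=
    ⟨_, Finset.univ, fun a _ => ⟨a, by simp, 1, by simp, by simp⟩, rfl⟩
  exact Nat.sInf_mem h

/-- The cyclic group `C_n = {z ∈ ℂ : z ^ n = 1}` of complex `n`-th roots of unity
(as a subgroup of `ℂˣ`; of order `n` for `n ≥ 1`). -/
abbrev cyclicGroupC (n : ℕ) : Subgroup ℂˣ := rootsOfUnity n ℂ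

/-!
For a prime `p` the group `C_{p² - p}` is isomorphic to `(ZMod p) × (ZMod p)ˣ`, because `p` and
`p - 1` are coprime. In this product Ruzsa's diagonal set `{(u, u)}` of `p - 1` elements realises
every difference `(a, b)` with `a ≠ 0` and `b ≠ 1` (`exists_units_of_ne`). The remaining differences
lie in one of the two factors, which are cyclic of orders `p` and `p - 1`. A complete ruler of length
at least `(p - 1) / 2` with `M` marks yields a difference basis of either factor, and translates
of the two bases can be made to share an element with the diagonal set. Hence
`Δ[C_{p² - p}] ≤ p - 1 + 2 (M - 1) = p - 3 + 2 M` (`differenceSize_zmod_prod_units_le`).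

It remains to find a ruler with `73 M² ≤ 144 (p - 1)`. Wichmann's rulers (`isRuler_wichmannRuler`)
of length `L` have about `√(3 L)` marks for the best choice of their parameters, that is
`M² ≈ 1.5 p`, while `144 / 73 ≈ 1.97`. This leaves enough room for the crude choice of parameters in
`exists_wichmann_params` when `p ≥ 257`; smaller `p ≥ 7` are checked directly
(`exists_short_ruler_params`). For `p ≤ 5` an explicit ruler on the whole group is used.
-/

/-! ### Complete rulers -/

/-- `S` is a (complete) ruler of length `L`: every integer distance `0, 1, …, L` is measured between
two marks of `S`. The marks may be arbitrary integers; they need not lie in `[0, L]`. -/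
def IsRuler (S : Finset ℤ) (L : ℤ) : Prop :=
  ∀ d, 0 ≤ d → d ≤ L → ∃ x ∈ S, ∃ y ∈ S, x - y = d

/-- The ruler with marks `0, 1, 4, 7, …, 3 s + 1, 3 s + 3`. -/
theorem exists_isRuler_three (s : ℤ) (hs : 0 ≤ s) :
    ∃ S : Finset ℤ, 0 ∈ S ∧ (S.card : ℤ) ≤ s + 3 ∧ IsRuler S (3 * s + 3) := by
  classical
  refine ⟨{0, 3 * s + 3} ∪ (Finset.Icc 0 s).image (fun i => 3 * i + 1), by simp, ?_, ?_⟩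
  · have h1 := Finset.card_union_le ({0, 3 * s + 3} : Finset ℤ)
      ((Finset.Icc 0 s).image (fun i => 3 * i + 1))
    have h2 : ((Finset.Icc 0 s).image (fun i => 3 * i + 1)).card ≤ _ := Finset.card_image_le
    have h3 := Finset.card_le_two (a := (0 : ℤ)) (b := 3 * s + 3)
    rw [Int.card_Icc] at h2
    omega
  · intro d hd hL
    have hC : ∀ i, 0 ≤ i → i ≤ s → 3 * i + 1 ∈ ({0, 3 * s + 3} : Finset ℤ) ∪
        (Finset.Icc 0 s).image (fun i => 3 * i + 1) := fun i h0 h1 =>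
      Finset.mem_union_right _ (Finset.mem_image_of_mem _ (Finset.mem_Icc.2 ⟨h0, h1⟩))
    obtain h | h | h : d % 3 = 0 ∨ d % 3 = 1 ∨ d % 3 = 2 := by omega
    · by_cases hd' : d = 3 * s + 3
      · exact ⟨3 * s + 3, by simp, 0, by simp, by omega⟩
      · exact ⟨_, hC (d / 3) (by omega) (by omega), _, hC 0 le_rfl hs, by omega⟩
    · exact ⟨_, hC (d / 3) (by omega) (by omega), 0, by simp, by omega⟩
    · exact ⟨3 * s + 3, by simp, _, hC (s - d / 3) (by omega) (by omega), by omega⟩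

/-- Wichmann's ruler with parameters `r = 2 w - 1` and `s`, whose consecutive gaps are
`1` (`r` times), `r + 1`, `2 r + 1` (`r` times), `4 r + 3` (`s` times), `2 r + 2` (`r + 1` times) and
`1` (`r` times). The five parts of the union are the marks joined by gaps of one kind; a mark where
two kinds meet is listed only once, so that the sizes of the parts add up to `8 w - 1 + s`. Only odd
`r` is considered, which avoids halves in the proof of completeness. -/
noncomputable def wichmannRuler (w s : ℤ) : Finset ℤ :=
  Finset.Ico 0 (2 * w) ∪ (Finset.Ico 1 (2 * w)).image (fun j => (4 * w - 1) * j) ∪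
    (Finset.Icc 0 s).image (fun i => (4 * w - 1) * (2 * w) + (8 * w - 1) * i) ∪
    (Finset.Ico 1 (2 * w)).image
      (fun k => (4 * w - 1) * (2 * w) + (8 * w - 1) * s + 4 * w * k) ∪
    (Finset.Ico 0 (2 * w)).image
      (fun x => (4 * w - 1) * (2 * w) + (8 * w - 1) * s + 8 * w ^ 2 + x)

theorem card_wichmannRuler_le {w s : ℤ} (hw : 1 ≤ w) (hs : 0 ≤ s) :
    ((wichmannRuler w s).card : ℤ) ≤ 8 * w - 1 + s := by
  have h : (wichmannRuler w s).card ≤ (2 * w).toNat + (2 * w - 1).toNat + (s + 1).toNat +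
      (2 * w - 1).toNat + (2 * w).toNat := by
    unfold wichmannRuler
    refine (Finset.card_union_le _ _).trans (add_le_add ((Finset.card_union_le _ _).trans
      (add_le_add ((Finset.card_union_le _ _).trans (add_le_add ((Finset.card_union_le _ _).trans
      (add_le_add ?_ ?_)) ?_)) ?_)) ?_)
    · simp
    all_goals exact Finset.card_image_le.trans (by simp)
  omega

section
variable {w s : ℤ}

theorem mem_wichmannRuler_start {x : ℤ} (h0 : 0 ≤ x) (h1 : x ≤ 2 * w - 1) :
    x ∈ wichmannRuler w s := by
  simp only [wichmannRuler, Finset.mem_union, Finset.mem_Ico]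
  exact .inl (.inl (.inl (.inl ⟨h0, by omega⟩)))

theorem mem_wichmannRuler_end {x : ℤ} (h0 : 0 ≤ x) (h1 : x ≤ 2 * w - 1) :
    (4 * w - 1) * (2 * w) + (8 * w - 1) * s + 8 * w ^ 2 + x ∈ wichmannRuler w s := by
  simp only [wichmannRuler, Finset.mem_union]
  exact .inr (Finset.mem_image_of_mem _ (Finset.mem_Ico.2 ⟨h0, by omega⟩))

theorem mem_wichmannRuler_mid {i : ℤ} (h0 : 0 ≤ i) (h1 : i ≤ s) :
    (4 * w - 1) * (2 * w) + (8 * w - 1) * i ∈ wichmannRuler w s := by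
  simp only [wichmannRuler, Finset.mem_union]
  exact .inl (.inl (.inr (Finset.mem_image_of_mem _ (Finset.mem_Icc.2 ⟨h0, h1⟩))))

/-- Together with the two marks where it meets its neighbours, the second part is a full arithmetic
progression. -/
theorem mem_wichmannRuler_left (hw : 1 ≤ w) (hs : 0 ≤ s) {j : ℤ} (h0 : 0 ≤ j) (h1 : j ≤ 2 * w) :
    (4 * w - 1) * j ∈ wichmannRuler w s := by
  rcases h0.eq_or_lt with rfl | h0
  · rw [mul_zero]
    exact mem_wichmannRuler_start le_rfl (by omega)
  rcases h1.eq_or_lt with rfl | h1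
  · have := mem_wichmannRuler_mid (w := w) le_rfl hs
    rwa [mul_zero, add_zero] at this
  simp only [wichmannRuler, Finset.mem_union]
  exact .inl (.inl (.inl (.inr (Finset.mem_image_of_mem _ (Finset.mem_Ico.2 ⟨h0, h1⟩)))))

/-- Together with the two marks where it meets its neighbours, the fourth part is a full arithmetic
progression. -/
theorem mem_wichmannRuler_right (hw : 1 ≤ w) (hs : 0 ≤ s) {k : ℤ} (h0 : 0 ≤ k) (h1 : k ≤ 2 * w) :
    (4 * w - 1) * (2 * w) + (8 * w - 1) * s + 4 * w * k ∈ wichmannRuler w s := by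
  rcases h0.eq_or_lt with rfl | h0
  · rw [mul_zero, add_zero]
    exact mem_wichmannRuler_mid hs le_rfl
  rcases h1.eq_or_lt with rfl | h1
  · have := mem_wichmannRuler_end (w := w) (s := s) (x := 0) le_rfl (by omega)
    convert this using 1
    ring
  simp only [wichmannRuler, Finset.mem_union]
  exact .inl (.inr (Finset.mem_image_of_mem _ (Finset.mem_Ico.2 ⟨h0, h1⟩)))

/-- Wichmann's ruler is complete. With `m = 8 w - 1`, the distances are written as `m * q + ρ` with
`-(3 w - 1) ≤ ρ ≤ 5 w - 1`. Since `2 (4 w - 1) ≡ -1` and `2 (4 w) ≡ 1` modulo `m`, the gaps on either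
side of the middle part move the residue in opposite directions. For each `ρ` the middle marks
realise `s + 1` consecutive values of `q`; the smaller and larger ones come from pairs of marks on
the same side of the middle part and on opposite sides of it, respectively. -/
theorem isRuler_wichmannRuler (hw : 1 ≤ w) (hs : 0 ≤ s) :
    IsRuler (wichmannRuler w s) ((8 * w - 1) * (2 * w + s) + 2 * w - 1) := by
  intro d hd hL
  have hA : ∀ x, 0 ≤ x → x ≤ 2 * w - 1 → x ∈ wichmannRuler w s :=
    fun x => mem_wichmannRuler_start
  -- The second part is indexed from its right end, so that the distance from a mark to the middle
  -- part is a multiple of its index.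
  have hB : ∀ j, 0 ≤ j → j ≤ 2 * w → (4 * w - 1) * (2 * w - j) ∈ wichmannRuler w s :=
    fun j h0 h1 => mem_wichmannRuler_left hw hs (by omega) (by omega)
  have hC : ∀ i, 0 ≤ i → i ≤ s →
      (4 * w - 1) * (2 * w) + (8 * w - 1) * i ∈ wichmannRuler w s :=
    fun i => mem_wichmannRuler_mid
  have hD : ∀ k, 0 ≤ k → k ≤ 2 * w →
      (4 * w - 1) * (2 * w) + (8 * w - 1) * s + 4 * w * k ∈ wichmannRuler w s :=
    fun k => mem_wichmannRuler_right hw hs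
  have hE : ∀ x, 0 ≤ x → x ≤ 2 * w - 1 →
      (4 * w - 1) * (2 * w) + (8 * w - 1) * s + 8 * w ^ 2 + x ∈ wichmannRuler w s :=
    fun x => mem_wichmannRuler_end
  obtain ⟨q, ρ, hρ0, hρ1, rfl⟩ : ∃ q ρ : ℤ, -(3 * w - 1) ≤ ρ ∧ ρ ≤ 5 * w - 1 ∧
      d = (8 * w - 1) * q + ρ := by
    have h1 := Int.emod_nonneg (d + (3 * w - 1)) (b := 8 * w - 1) (by omega)
    have h2 := Int.emod_lt_of_pos (d + (3 * w - 1)) (b := 8 * w - 1) (by omega)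
    have h3 := Int.mul_ediv_add_emod (d + (3 * w - 1)) (8 * w - 1)
    exact ⟨(d + (3 * w - 1)) / (8 * w - 1), (d + (3 * w - 1)) % (8 * w - 1) - (3 * w - 1),
      by linarith, by linarith, by linarith⟩
  have hq0 : 0 ≤ q := by
    by_contra h
    nlinarith
  have hq1 : ρ < 0 → 1 ≤ q := by
    intro h
    by_contra h'
    obtain rfl : q = 0 := by omega
    omega
  have hq2 : q ≤ 2 * w + s := by
    by_contra h
    nlinarith
  have hq3 : 2 * w ≤ ρ → q ≤ 2 * w + s - 1 := by
    intro h
    by_contra h'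
    obtain rfl : q = 2 * w + s := by omega
    linarith
  rcases lt_or_ge ρ (-w) with h1 | h1
  · have hq1 := hq1 (by omega)
    rcases lt_or_ge q w with h2 | h2
    · rcases le_or_gt (-ρ - q) (2 * w - 1) with h3 | h3
      · exact ⟨_, hB (2 * w - 2 * q) (by omega) (by omega), _, hA (-ρ - q) (by omega) h3, by ring⟩
      · exact ⟨_, hE (4 * w - q + ρ) (by omega) (by omega),
          _, hD (2 * w - (2 * q - 1)) (by omega) (by omega), by ring⟩
    rcases le_or_gt q (w + s) with h3 | h3
    · exact ⟨_, hC (q - w) (by omega) (by omega), _, hA (-ρ - w) (by omega) (by omega), by ring⟩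
    rcases le_or_gt (q - w - s - ρ - w) (2 * w - 1) with h4 | h4
    · exact ⟨_, hD (2 * (q - w - s)) (by omega) (by omega), _, hA (q - w - s - ρ - w) (by omega) h4,
        by ring⟩
    · exact ⟨_, hE (2 * w + q - s - 1 + ρ) (by omega) (by omega),
        _, hB (2 * (q - w - s) - 1) (by omega) (by omega), by ring⟩
  rcases lt_or_ge ρ 0 with h2 | h2
  · rcases lt_or_ge q (-ρ) with h3 | h3
    · exact ⟨_, hB (2 * w - 2 * q) (by omega) (by omega), _, hA (-ρ - q) (by omega) (by omega),
        by ring⟩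
    rcases le_or_gt q (-ρ + s) with h4 | h4
    · exact ⟨_, hC (q + ρ) (by omega) (by omega), _, hB (-2 * ρ) (by omega) (by omega), by ring⟩
    rcases le_or_gt (q - s - ρ) (2 * w) with h5 | h5
    · exact ⟨_, hD (q + ρ - s) (by omega) (by omega), _, hB (q - s - ρ) (by omega) (by omega),
        by ring⟩
    · exact ⟨_, hD (2 * (q - w - s)) (by omega) (by omega),
        _, hA (q - s - ρ - 2 * w) (by omega) (by omega), by ring⟩
  rcases lt_or_ge ρ w with h3 | h3
  · rcases lt_or_ge q ρ with h4 | h4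
    · exact ⟨_, hE (ρ - q) (by omega) (by omega), _, hD (2 * (w - q)) (by omega) (by omega), by ring⟩
    rcases le_or_gt q (ρ + s) with h5 | h5
    · exact ⟨_, hD (2 * ρ) (by omega) (by omega), _, hC (s - (q - ρ)) (by omega) (by omega), by ring⟩
    rcases le_or_gt (q + ρ - s) (2 * w) with h6 | h6
    · exact ⟨_, hD (q + ρ - s) (by omega) (by omega), _, hB (q - ρ - s) (by omega) (by omega),
        by ring⟩
    · exact ⟨_, hE (q + ρ - s - 2 * w) (by omega) (by omega),
        _, hB (2 * (q - s - w)) (by omega) (by omega), by ring⟩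
  rcases lt_or_ge ρ (3 * w) with h4 | h4
  · rcases lt_or_ge q w with h5 | h5
    · rcases le_or_gt (ρ - q) (2 * w - 1) with h6 | h6
      · exact ⟨_, hE (ρ - q) (by omega) h6, _, hD (2 * (w - q)) (by omega) (by omega), by ring⟩
      · exact ⟨_, hB (2 * w - (2 * q + 1)) (by omega) (by omega),
          _, hA (4 * w - 1 - q - ρ) (by omega) (by omega), by ring⟩
    rcases le_or_gt q (w + s) with h6 | h6
    · exact ⟨_, hE (ρ - w) (by omega) (by omega), _, hC (s - (q - w)) (by omega) (by omega), by ring⟩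
    rcases le_or_gt (ρ - 2 * w + q - s) (2 * w - 1) with h7 | h7
    · exact ⟨_, hE (ρ - 2 * w + q - s) (by omega) h7,
        _, hB (2 * (q - w - s)) (by omega) (by omega), by ring⟩
    · exact ⟨_, hD (2 * (q - w - s) + 1) (by omega) (by omega),
        _, hA (2 * w + q - s - ρ) (by omega) (by omega), by ring⟩
  have hq3 := hq3 (by omega)
  rcases lt_or_ge ρ (4 * w) with h5 | h5
  · obtain ⟨v, rfl⟩ : ∃ v, ρ = 4 * w - 1 - v := ⟨4 * w - 1 - ρ, by ring⟩
    rcases lt_or_ge q v with h6 | h6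
    · exact ⟨_, hB (2 * w - (2 * q + 1)) (by omega) (by omega), _, hA (v - q) (by omega) (by omega),
        by ring⟩
    rcases le_or_gt q (v + s) with h7 | h7
    · exact ⟨_, hC (q - v) (by omega) (by omega), _, hB (2 * v + 1) (by omega) (by omega), by ring⟩
    rcases le_or_gt (v + 1 + q - s) (2 * w) with h8 | h8
    · exact ⟨_, hD (q - v - s) (by omega) (by omega), _, hB (v + 1 + q - s) (by omega) h8, by ring⟩
    · exact ⟨_, hD (2 * (q - w - s) + 1) (by omega) (by omega),
        _, hA (v + 1 + q - s - 2 * w) (by omega) (by omega), by ring⟩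
  · obtain ⟨u, rfl⟩ : ∃ u, ρ = 4 * w + u := ⟨ρ - 4 * w, by ring⟩
    rcases lt_or_ge q u with h6 | h6
    · exact ⟨_, hE (u - q) (by omega) (by omega),
        _, hD (2 * w - (2 * q + 1)) (by omega) (by omega), by ring⟩
    rcases le_or_gt q (u + s) with h7 | h7
    · exact ⟨_, hD (2 * u + 1) (by omega) (by omega), _, hC (s - (q - u)) (by omega) (by omega),
        by ring⟩
    rcases le_or_gt (u + 1 + q - s) (2 * w) with h8 | h8
    · exact ⟨_, hD (u + 1 + q - s) (by omega) h8, _, hB (q - u - s) (by omega) (by omega), by ring⟩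
    · exact ⟨_, hE (u + 1 + q - s - 2 * w) (by omega) (by omega),
        _, hB (2 * (q - w - s) + 1) (by omega) (by omega), by ring⟩
end

/-! ### Rulers with at most `√(144 (p - 1) / 73)` marks -/

set_option maxRecDepth 10000 in
set_option synthInstance.maxSize 1000 in
/-- Parameters of a short enough ruler of length at least `k` when `2 k + 1 < 257`. The first
alternative belongs to `exists_isRuler_three`, the second to `wichmannRuler (w + 1) s`. The excluded values of `k`
correspond to the composite numbers `2 k + 1 = 9` and `33`, for which neither family is short
enough. -/
theorem exists_short_ruler_params : ∀ k < 128, 3 ≤ k → k ≠ 4 → k ≠ 16 →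
    (∃ s < 10, k ≤ 3 * s + 3 ∧ 73 * (s + 3) ^ 2 ≤ 288 * k) ∨
    ∃ w < 2, ∃ s < 12, k ≤ (8 * w + 7) * (2 * w + 2 + s) + 2 * w + 1 ∧
      73 * (8 * w + 7 + s) ^ 2 ≤ 288 * k := by
  decide

/-- Parameters of a short enough ruler of length at least `N / 2`, for `N ≥ 256`: the first
parameter is `w = ⌊√N / 8⌋`, and `s` is the least number of middle gaps that makes the ruler
long enough. -/
theorem exists_wichmann_params (N : ℤ) (hN : 256 ≤ N) : ∃ w s : ℤ, 1 ≤ w ∧ 0 ≤ s ∧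
      N ≤ 2 * ((8 * w - 1) * (2 * w + s) + 2 * w - 1) ∧
      73 * (8 * w - 1 + s) ^ 2 ≤ 144 * N := by
  obtain ⟨w, hw, h1, h2⟩ : ∃ w : ℤ, 2 ≤ w ∧ 64 * w ^ 2 ≤ N ∧ N < 64 * (w + 1) ^ 2 := by
    lift N to ℕ using by omega
    have h := Nat.sqrt_le' (N / 64)
    have h' := Nat.lt_succ_sqrt' (N / 64)
    have h4 : 2 ≤ Nat.sqrt (N / 64) := Nat.le_sqrt.2 (by omega)
    refine ⟨Nat.sqrt (N / 64), by exact_mod_cast h4, ?_, ?_⟩ <;> norm_cast <;> grind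
  -- `t = 2 w + s`, as the length of the ruler is linear in this quantity.
  obtain ⟨t, ht0, ht1⟩ : ∃ t : ℤ, N ≤ 2 * ((8 * w - 1) * t + 2 * w - 1) ∧
      2 * ((8 * w - 1) * (t - 1) + 2 * w - 1) < N := by
    have h1 := Int.emod_nonneg (N - 4 * w + 1) (b := 16 * w - 2) (by omega)
    have h2 := Int.emod_lt_of_pos (N - 4 * w + 1) (b := 16 * w - 2) (by omega)
    have h3 := Int.mul_ediv_add_emod (N - 4 * w + 1) (16 * w - 2)
    exact ⟨(N - 4 * w + 1) / (16 * w - 2) + 1, by linarith, by linarith⟩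
  have h3 : 4 * w ≤ t := by
    by_contra h
    nlinarith
  have h4 : 6 * w + t - 1 ≤ 16 * w  := by
    by_contra h
    nlinarith
  refine ⟨w, t - 2 * w, by omega, by omega, ?_, ?_⟩
  · linarith
  -- The inequality is quadratic and convex in `t`, so the bounds `h3` and `h4` suffice.
  · have : 73 * (8 * w - 1 + (t - 2 * w)) ^ 2 ≤
        288 * ((8 * w - 1) * (t - 1) + 2 * w - 1) := by
      nlinarith
    linarith

theorem exists_isRuler_of_prime {p : ℕ} (hp : p.Prime) (h7 : 7 ≤ p) :
    ∃ (S : Finset ℤ) (L : ℤ), 0 ∈ S ∧ IsRuler S L ∧ (p : ℤ) ≤ 2 * L + 1 ∧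
      73 * (S.card : ℤ) ^ 2 ≤ 144 * ((p : ℤ) - 1) := by
  -- `2 * ((8 * w - 1) * (2 * w + s) + 2 * w - 1)` is twice the length of Wichmann's ruler.
  have key : ∀ w s : ℤ, 1 ≤ w → 0 ≤ s →
      (p : ℤ) - 1 ≤ 2 * ((8 * w - 1) * (2 * w + s) + 2 * w - 1) →
      73 * (8 * w - 1 + s) ^ 2 ≤ 144 * ((p : ℤ) - 1) →
      ∃ (S : Finset ℤ) (L : ℤ), 0 ∈ S ∧ IsRuler S L ∧ (p : ℤ) ≤ 2 * L + 1 ∧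
        73 * (S.card : ℤ) ^ 2 ≤ 144 * ((p : ℤ) - 1) := fun w s hw hs h1 h2 =>
    ⟨wichmannRuler w s, _, mem_wichmannRuler_start le_rfl (by omega), isRuler_wichmannRuler hw hs,
      by linarith, h2.trans' (by gcongr; exact card_wichmannRuler_le hw hs)⟩
  rcases le_or_gt 257 p with h | h
  · obtain ⟨w, s, hw, hs, h1, h2⟩ := exists_wichmann_params ((p : ℤ) - 1) (by omega)
    exact key w s hw hs h1 h2
  obtain ⟨k, rfl⟩ := hp.odd_of_ne_two (by omega)
  rcases exists_short_ruler_params k (by omega) (by omega) (by rintro rfl; norm_num at hp)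
    (by rintro rfl; norm_num at hp) with ⟨s, -, h1, h2⟩ | ⟨w, -, s, -, h1, h2⟩
  · obtain ⟨S, h0, hcard, hS⟩ := exists_isRuler_three s (by omega)
    refine ⟨S, _, h0, hS, by push_cast; omega, ?_⟩
    have h3 : 73 * (S.card : ℤ) ^ 2 ≤ 73 * ((s : ℤ) + 3) ^ 2 := by gcongr
    zify at h2
    push_cast
    linarith
  · zify at h1 h2
    refine key (w + 1) s (by omega) (by omega) ?_ ?_ <;> push_cast <;> linarith

/-! ### From rulers to difference bases -/

section
variable {G : Type*} [Group G]

theorem differenceSize_univ_le_card {B : Finset G} (h : IsDifferenceBasis (B : Set G) Set.univ) :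
    differenceSize (Set.univ : Set G) ≤ B.card :=
  Nat.sInf_le ⟨B, h, rfl⟩

theorem differenceSize_univ_le_of_mulEquiv {H : Type*} [Group H] [Finite G] (e : G ≃* H) :
    differenceSize (Set.univ : Set H) ≤ differenceSize (Set.univ : Set G) := by
  obtain ⟨B, hB, hcard⟩ := exists_isDifferenceBasis_card_eq (Set.univ : Set G)
  rw [← hcard, ← Finset.card_map e.toEquiv.toEmbedding]
  refine differenceSize_univ_le_card fun a _ => ?_
  obtain ⟨x, hx, y, hy, h⟩ := hB (e.symm a) trivial
  exact ⟨e x, by simpa using hx, e y, by simpa using hy, by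
    rw [← map_inv, ← map_mul, ← h, e.apply_symm_apply]⟩

/-- In a cyclic group of order `n` a ruler of length `⌊n / 2⌋` is enough: the powers with larger
exponents below `n` are inverses of powers with smaller ones. -/
theorem exists_zpow_div_of_isRuler {S : Finset ℤ} {L : ℤ} (hS : IsRuler S L) {g : G} {n : ℕ}
    (hn : 0 < n) (hg : g ^ n = 1) (hL : (n : ℤ) ≤ 2 * L + 1) {a : G}
    (ha : a ∈ Subgroup.zpowers g) : ∃ x ∈ S, ∃ y ∈ S, a = g ^ x * (g ^ y)⁻¹ := by
  obtain ⟨k, rfl⟩ := Subgroup.mem_zpowers_iff.1 ha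
  have hg' : g ^ (n : ℤ) = 1 := by simpa using hg
  have h1 := Int.emod_nonneg k (b := n) (by omega)
  have h2 := Int.emod_lt_of_pos k (b := n) (by omega)
  have hk : g ^ k = g ^ (k % n) := by
    conv_lhs => rw [← Int.mul_ediv_add_emod k n, zpow_add, zpow_mul, hg', one_zpow, one_mul]
  rcases le_or_gt (k % n) L with h | h
  · obtain ⟨x, hx, y, hy, hxy⟩ := hS _ h1 h
    exact ⟨x, hx, y, hy, by rw [hk, ← hxy, zpow_sub]⟩
  · obtain ⟨x, hx, y, hy, hxy⟩ := hS (n - k % n) (by omega) (by omega)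
    refine ⟨y, hy, x, hx, ?_⟩
    rw [← zpow_sub, hk, show y - x = k % n - n by omega, zpow_sub, hg', inv_one, mul_one]

theorem differenceSize_le_card_of_isRuler [IsCyclic G] [Finite G] {S : Finset ℤ} {L : ℤ}
    (hS : IsRuler S L) (hL : (Nat.card G : ℤ) ≤ 2 * L + 1) :
    differenceSize (Set.univ : Set G) ≤ S.card := by
  classical
  obtain ⟨g, hg⟩ := IsCyclic.exists_generator (α := G)
  refine (differenceSize_univ_le_card (B := S.image (g ^ ·)) fun a _ => ?_).trans
    Finset.card_image_le
  obtain ⟨x, hx, y, hy, h⟩ := exists_zpow_div_of_isRuler hS Nat.card_pos pow_card_eq_one' hL (hg a)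
  exact ⟨_, by simpa using ⟨x, hx, rfl⟩, _, by simpa using ⟨y, hy, rfl⟩, h⟩

end

section
variable {F : Type*} [Field F]

/-- Ruzsa's observation: the differences of the diagonal set `{(u, u) : u ≠ 0}` in `F × Fˣ` include
all pairs `(a, b)` with both components nontrivial, because the system `u - v = a`, `u / v = b` has the
solution `v = a / (b - 1)`, `u = b v`. -/
theorem exists_units_of_ne {a : F} {b : Fˣ} (ha : a ≠ 0) (hb : b ≠ 1) :
    ∃ u v : Fˣ, (Multiplicative.ofAdd a, b) =
      ((Multiplicative.ofAdd (u : F), u) : Multiplicative F × Fˣ) *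
        (Multiplicative.ofAdd (v : F), v)⁻¹ := by
  have hb' : (b : F) - 1 ≠ 0 := sub_ne_zero.2 (by simpa using hb)
  refine ⟨b * Units.mk0 (a / (b - 1)) (div_ne_zero ha hb'), Units.mk0 _ (div_ne_zero ha hb'), ?_⟩
  refine Prod.ext ?_ (by simp)
  change Multiplicative.ofAdd a = Multiplicative.ofAdd _ * (Multiplicative.ofAdd _)⁻¹
  rw [← ofAdd_neg, ← ofAdd_add]
  congr 1
  simp
  field_simp
  ring
end

/-- Two copies of a ruler, one along each factor, supply the differences that Ruzsa's diagonal set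
misses. Both are translated so that their mark `0` falls on the diagonal element `(1, 1)`, which
therefore is counted only once. -/
theorem differenceSize_zmod_prod_units_le {p : ℕ} [Fact p.Prime] {S : Finset ℤ} {L : ℤ}
    (hS : IsRuler S L) (h0 : 0 ∈ S) (hL : (p : ℤ) ≤ 2 * L + 1) :
    differenceSize (Set.univ : Set (Multiplicative (ZMod p) × (ZMod p)ˣ)) ≤
      (p - 1) + 2 * (S.card - 1) := by
  classical
  have hp := (Fact.out : p.Prime)
  obtain ⟨ζ, hζ⟩ := IsCyclic.exists_generator (α := (ZMod p)ˣ)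
  obtain ⟨γ, hγ⟩ := IsCyclic.exists_generator (α := Multiplicative (ZMod p))
  let r : (ZMod p)ˣ → Multiplicative (ZMod p) × (ZMod p)ˣ :=
    fun u => (Multiplicative.ofAdd (u : ZMod p), u)
  let R := (Finset.univ : Finset (ZMod p)ˣ).image r
  let B₁ := (S.erase 0).image fun x => r 1 * (γ, 1) ^ x
  let B₂ := (S.erase 0).image fun x => r 1 * (1, ζ) ^ x
  have hR : ∀ u, r u ∈ R ∪ B₁ ∪ B₂ := fun u => by simp [R]
  have hB₁ : ∀ x ∈ S, r 1 * (γ, 1) ^ x ∈ R ∪ B₁ ∪ B₂ := fun x hx => by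
    by_cases h : x = 0
    · simpa [h] using hR 1
    · exact Finset.mem_union_left _ (Finset.mem_union_right _
        (Finset.mem_image_of_mem _ (Finset.mem_erase.2 ⟨h, hx⟩)))
  have hB₂ : ∀ x ∈ S, r 1 * (1, ζ) ^ x ∈ R ∪ B₁ ∪ B₂ := fun x hx => by
    by_cases h : x = 0
    · simpa [h] using hR 1
    · exact Finset.mem_union_right _
        (Finset.mem_image_of_mem _ (Finset.mem_erase.2 ⟨h, hx⟩))
  have hcard : (R ∪ B₁ ∪ B₂).card ≤ (p - 1) + 2 * (S.card - 1) := by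
    have h1 : R.card ≤ p - 1 := by
      refine Finset.card_image_le.trans ?_
      rw [Finset.card_univ, ZMod.card_units]
    have h2 : B₁.card ≤ S.card - 1 := by
      rw [← Finset.card_erase_of_mem h0]
      exact Finset.card_image_le
    have h3 : B₂.card ≤ S.card - 1 := by
      rw [← Finset.card_erase_of_mem h0]
      exact Finset.card_image_le
    have h4 := Finset.card_union_le (R ∪ B₁) B₂
    have h5 := Finset.card_union_le R B₁
    omega
  refine (differenceSize_univ_le_card ?_).trans hcard
  have hn := hp.two_le
  rintro ⟨a, b⟩ -
  by_cases hb : b = 1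
  · subst hb
    obtain ⟨x, hx, y, hy, h⟩ := exists_zpow_div_of_isRuler hS (Nat.card_pos (α := ZMod p))
      (pow_card_eq_one' (x := γ)) (by simpa using hL) (hγ a)
    refine ⟨_, hB₁ x hx, _, hB₁ y hy, ?_⟩
    rw [mul_inv, mul_mul_mul_comm, mul_inv_cancel, one_mul]
    exact Prod.ext h (by simp)
  by_cases ha : a = 1
  · subst ha
    obtain ⟨x, hx, y, hy, h⟩ := exists_zpow_div_of_isRuler hS (Nat.card_pos (α := (ZMod p)ˣ))
      (pow_card_eq_one' (x := ζ))
      (by rw [Nat.card_eq_fintype_card, ZMod.card_units]; omega) (hζ b)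
    refine ⟨_, hB₂ x hx, _, hB₂ y hy, ?_⟩
    rw [mul_inv, mul_mul_mul_comm, mul_inv_cancel, one_mul]
    exact Prod.ext (by simp) h
  · obtain ⟨u, v, h⟩ := exists_units_of_ne (a := a.toAdd) (by simpa using ha) hb
    exact ⟨_, hR u, _, hR v, h⟩

theorem card_rootsOfUnity_sq_sub {p : ℕ} (hp : p.Prime) :
    Nat.card (rootsOfUnity (p ^ 2 - p) ℂ) = p * (p - 1) := by
  have h : p ^ 2 - p = p * (p - 1) := by rw [Nat.mul_sub, mul_one, sq]
  have : NeZero (p ^ 2 - p) := ⟨by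
    rw [h]; exact (Nat.mul_pos hp.pos (Nat.sub_pos_of_lt hp.one_lt)).ne'⟩
  rw [Complex.card_rootsOfUnity, h]

/-- `p` and `p - 1` are coprime, so the product of the additive and the multiplicative group of the
field with `p` elements is cyclic of order `p (p - 1)`. -/
theorem nonempty_mulEquiv_rootsOfUnity_sq_sub {p : ℕ} [Fact p.Prime] :
    Nonempty (Multiplicative (ZMod p) × (ZMod p)ˣ ≃* rootsOfUnity (p ^ 2 - p) ℂ) := by
  have hp := (Fact.out : p.Prime)
  have hc := card_rootsOfUnity_sq_sub hp
  have : NeZero (p ^ 2 - p) := ⟨(Nat.sub_pos_of_lt (lt_self_pow₀ hp.one_lt one_lt_two)).ne'⟩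
  have h1 : Nat.card (ZMod p)ˣ = p - 1 := by rw [Nat.card_eq_fintype_card, ZMod.card_units]
  have h2 : Nat.card (Multiplicative (ZMod p)) = p := by simp
  have : IsCyclic (Multiplicative (ZMod p) × (ZMod p)ˣ) := by
    rw [Group.isCyclic_prod_iff]
    refine ⟨inferInstance, inferInstance, ?_⟩
    rw [h1, h2]
    exact (Nat.coprime_self_sub_right hp.one_le).2 (Nat.coprime_one_right p)
  exact ⟨mulEquivOfCyclicCardEq (by rw [Nat.card_prod, h1, h2, hc])⟩

/-! ### The bound -/

theorem le_twelve_div_sqrt_mul_sqrt {m x : ℝ} (hx : 0 ≤ x) (h : 73 * m ^ 2 ≤ 144 * x) :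
    m ≤ 12 / √73 * √x := by
  rw [div_mul_eq_mul_div, le_div_iff₀ (by positivity)]
  refine le_of_sq_le_sq ?_ (by positivity)
  rw [mul_pow, mul_pow, Real.sq_sqrt hx, Real.sq_sqrt (by norm_num)]
  linarith

theorem differenceSize_le_of_ruler {p : ℕ} (hp : p.Prime) {S : Finset ℤ} {L : ℤ} (hS : IsRuler S L)
    (hL : (p : ℤ) * (p - 1) ≤ 2 * L + 1) :
    differenceSize (Set.univ : Set (cyclicGroupC (p ^ 2 - p))) ≤ S.card := by
  have hc := card_rootsOfUnity_sq_sub hp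
  have : NeZero (p ^ 2 - p) := ⟨(Nat.sub_pos_of_lt (lt_self_pow₀ hp.one_lt one_lt_two)).ne'⟩
  refine differenceSize_le_card_of_isRuler hS ?_
  rw [hc, Nat.cast_mul, Nat.cast_sub hp.one_le]
  exact_mod_cast hL

theorem mainTheorem10 (p : ℕ) (hp : p.Prime) :
    (differenceSize (Set.univ : Set (cyclicGroupC (p ^ 2 - p))) : ℝ) ≤
      (p : ℝ) - 3 + 12 / Real.sqrt 73 * (Real.sqrt (p : ℝ) + Real.sqrt ((p : ℝ) - 1)) := by
  have hp1 : (1 : ℝ) ≤ p := by exact_mod_cast hp.one_le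
  -- For small `p` a single ruler on the whole group suffices; `a` and `b` are rational lower bounds
  -- for the two irrational terms.
  have small : ∀ {S : Finset ℤ} {L : ℤ} (a b : ℝ), IsRuler S L →
      (p : ℤ) * (p - 1) ≤ 2 * L + 1 → 73 * a ^ 2 ≤ 144 * p → 73 * b ^ 2 ≤ 144 * (p - 1) →
      (S.card : ℝ) ≤ p - 3 + a + b →
      (differenceSize (Set.univ : Set (cyclicGroupC (p ^ 2 - p))) : ℝ) ≤
      (p : ℝ) - 3 + 12 / √73 * (√(p : ℝ) + √((p : ℝ) - 1)) := by
    intro S L a b hS hL ha hb hab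
    have h1 : (differenceSize (Set.univ : Set (cyclicGroupC (p ^ 2 - p))) : ℝ) ≤ S.card := by
      exact_mod_cast differenceSize_le_of_ruler hp hS hL
    have h2 := le_twelve_div_sqrt_mul_sqrt (by linarith) ha
    have h3 := le_twelve_div_sqrt_mul_sqrt (by linarith) hb
    rw [mul_add]
    linarith
  rcases lt_or_ge p 7 with h7 | h7
  · interval_cases p
    any_goals norm_num at hp
    · exact small (S := {0, 1}) (L := 1) (19 / 10) (13 / 10)
        (fun d h0 h1 => by interval_cases d <;> decide) (by norm_num) (by norm_num) (by norm_num)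
        (by norm_num)
    · exact small (S := {0, 1, 3}) (L := 3) 2 1
        (fun d h0 h1 => by interval_cases d <;> decide) (by norm_num) (by norm_num) (by norm_num)
        (by norm_num)
    · exact small (S := {0, 1, 2, 5, 8, 10}) (L := 10) 2 2
        (fun d h0 h1 => by interval_cases d <;> decide) (by norm_num) (by norm_num) (by norm_num)
        (by norm_num)
  have : Fact p.Prime := ⟨hp⟩
  obtain ⟨S, L, h0, hS, hL, hcard⟩ := exists_isRuler_of_prime hp h7
  obtain ⟨e⟩ := nonempty_mulEquiv_rootsOfUnity_sq_sub (p := p)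
  have hS1 : 1 ≤ S.card := Finset.card_pos.2 ⟨0, h0⟩
  have h1 : (differenceSize (Set.univ : Set (cyclicGroupC (p ^ 2 - p))) : ℝ) ≤
      p - 1 + 2 * (S.card - 1) := by
    have := (differenceSize_univ_le_of_mulEquiv e).trans (differenceSize_zmod_prod_units_le hS h0 hL)
    have := (Nat.cast_le (α := ℝ)).2 this
    rwa [Nat.cast_add, Nat.cast_mul, Nat.cast_sub hp.one_le, Nat.cast_sub hS1, Nat.cast_one,
      Nat.cast_two] at this
  have hcard' : 73 * (S.card : ℝ) ^ 2 ≤ 144 * ((p : ℝ) - 1) := by exact_mod_cast hcard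
  have h2 := le_twelve_div_sqrt_mul_sqrt (m := S.card) (x := p) (by linarith) (by linarith)
  have h3 := le_twelve_div_sqrt_mul_sqrt (by linarith) hcard'
  rw [mul_add]
  linarith
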